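/- For a permutation $\pi$ of $[m]=\{1,\dots,m\}$, say that $\pi$ avoids $321$ if there are no indices $a<b<c$ with $\pi(a)>\pi(b)>\pi(c)$. For $n\ge 1$ let $\mathrm{Av}^\star_{3n}(321)$ be the set of permutations of $[3n]$ that avoid $321$ and whose cycle decomposition consists only of $3$-cycles (in particular there are no fixed points). Then for all $n\ge 1$, \[ |\mathrm{Av}^\star_{3n}(321)|=\sum_{D\in\mathcal D_n}2^{h(D)}\prod_{i=1}^{n-1}\binom{r_i(D)+s_i(D)}{r_i(D)}, \] where $\mathcal D_n$ is the set of Dyck words of semilength $n$ on $\{x,y\}$, that is, words with $n$ letters $x$ and $n$ letters $y$ in which every initial segment contains at least as many $x$'s as $y$'s; $h(D)$ is the number of nonempty initial segments of $D$ (including $D$ itself) with equally many $x$'s and $y$'s; $r_i(D)$ is the number of $y$'s between the $i$-th $x$ and the $(i+1)$-st $x$ of $D$; and $s_i(D)$ is the number of $x$'s between the $i$-th $y$ and the $(i+1)$-st $y$ of $D$. -/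

import Mathlib

namespace ThreeCycles

/-- `π` avoids the pattern `σ`: no subsequence of the one-line notation of `π`, taken at the
positions `f 0 < f 1 < ⋯ < f (k - 1)`, is in the same relative order as `σ`. -/
def Avoids {m k : ℕ} (π : Equiv.Perm (Fin m)) (σ : Equiv.Perm (Fin k)) : Prop :=
  ¬ ∃ f : Fin k ↪o Fin m, ∀ i j : Fin k, π (f i) < π (f j) ↔ σ i < σ j

/-- The permutations of `3n` points, all of whose cycles are 3-cycles (there are then `n` of
them, and no fixed points), that avoid `σ`. -/
def avStar (n : ℕ) {k : ℕ} (σ : Equiv.Perm (Fin k)) : Set (Equiv.Perm (Fin (3 * n))) :=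
  {π | π.cycleType = Multiset.replicate n 3 ∧ Avoids π σ}

/-- The pattern `321`, as a permutation of three points in one-line notation. -/
def pattern321 : Equiv.Perm (Fin 3) := Fin.revPerm

/-- The number of nonempty initial segments of `D` with equally many letters `x = U`
and `y = D`. -/
def h (D : DyckWord) : ℕ :=
  ((Finset.Icc 1 D.toList.length).filter fun k =>
    (D.toList.take k).count DyckStep.U = (D.toList.take k).count DyckStep.D).card

/-- The number of letters `b` in `w` lying between the `i`-th and the `(i+1)`-st letter `a`
(occurrences numbered from 1), that is, the number of positions `p` holding a `b` such that
exactly `i` letters `a` stand before `p`. -/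
def between (w : List DyckStep) (a b : DyckStep) (i : ℕ) : ℕ :=
  (Finset.univ.filter fun p : Fin w.length =>
    w.get p = b ∧ (w.take p).count a = i).card

/-- The number of `y`'s between the `i`-th and the `(i+1)`-st `x`. -/
def r (D : DyckWord) (i : ℕ) : ℕ := between D.toList DyckStep.U DyckStep.D i

/-- The number of `x`'s between the `i`-th and the `(i+1)`-st `y`. -/
def s (D : DyckWord) (i : ℕ) : ℕ := between D.toList DyckStep.D DyckStep.U i

end ThreeCycles

/-!
Avoiding `321` means that `π` is increasing on its weak excedances and `π⁻¹` on its own. Sort each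
3-cycle of `π` increasingly into a column of a `3 × n` array, the columns ordered by their least
entries; what remains of `π` is the direction in which each column is rotated. The criterion then
says that the rows increase, that rows `1` and `2` are interleaved in the same way as rows `0` and
`1`, and that adjacent columns may be rotated in opposite directions only where rows `1` and `2`
of the left one lie below those of the right one. Reading the upper of the two rows as `U` and the
lower one as `D`, the common interleaving is a Dyck word `p`. Directions may change exactly at the
returns of `p` other than the last one, which gives `2 ^ h p` choices. An array with interleaving
`p` is a word in three letters whose letters `0, 1` and whose letters `1, 2` both spell `p`, and
such words are counted gap by gap between the letters `1`: there the remaining letters of the two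
copies of `p` are shuffled freely.
-/

namespace ThreeCycles

open DyckStep

section Avoidance

variable {α : Type*} [LinearOrder α] {π : Equiv.Perm α}

/-- The set of weak excedances of a permutation. The weak deficiencies of `π` are the images under
`π⁻¹` of the weak excedances of `π⁻¹`. -/
def excedances (π : Equiv.Perm α) : Set α := {x | x ≤ π x}

/-- Avoidance of `321` by a permutation of an arbitrary linear order, in terms of the values at
three increasing positions. -/
def Avoids321 (π : Equiv.Perm α) : Prop :=
  ∀ ⦃a b c⦄, a < b → b < c → π b < π a → π b ≤ π c

theorem avoids_pattern321_iff {m : ℕ} (π : Equiv.Perm (Fin m)) :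
    Avoids π pattern321 ↔ Avoids321 π := by
  constructor
  · intro H a b c hab hbc hba
    by_contra! hcb
    have hca := hcb.trans hba
    refine H ⟨OrderEmbedding.ofStrictMono ![a, b, c] ?_, fun i j => ?_⟩
    · simp [hab, hbc]
    · change π (![a, b, c] i) < π (![a, b, c] j) ↔ i.rev < j.rev
      fin_cases i <;> fin_cases j <;> simp [hba, hcb, hca, hba.le, hcb.le, hca.le]
  · rintro H ⟨f, hf⟩
    have hba : π (f 1) < π (f 0) := (hf 1 0).2 (by decide)
    have hcb : π (f 2) < π (f 1) := (hf 2 1).2 (by decide)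
    exact (H (f.strictMono (by decide)) (f.strictMono (by decide)) hba).not_gt hcb

theorem Avoids321.inv (hπ : Avoids321 π) : Avoids321 π⁻¹ := by
  intro a b c hab hbc hba
  by_contra! hcb
  exact (hπ hcb hba (by simpa using hbc)).not_gt (by simpa using hab)

theorem Avoids321.strictMonoOn_excedances [Finite α] (hπ : Avoids321 π) :
    StrictMonoOn π (excedances π) := by
  intro x _ y hy hxy
  by_contra! hle
  have hyx : π y < π x := hle.lt_of_ne (π.injective.ne hxy.ne')
  -- Everything from `x` and from above `y` would have to be mapped above `π y ≥ y`.
  have hmaps : Set.MapsTo π (insert x (Set.Ioi y)) (Set.Ioi y) := by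
    rintro z (rfl | hz)
    · exact lt_of_le_of_lt hy hyx
    · exact lt_of_le_of_lt hy ((hπ hxy hz hyx).lt_of_ne (π.injective.ne (ne_of_lt hz)))
  have hcard := Set.ncard_le_ncard_of_injOn π hmaps π.injective.injOn
  rw [Set.ncard_insert_of_notMem (Set.notMem_Ioi.2 hxy.le)] at hcard
  omega

theorem avoids321_iff_strictMonoOn_excedances [Finite α] :
    Avoids321 π ↔
      StrictMonoOn π (excedances π) ∧ StrictMonoOn ⇑π⁻¹ (excedances π⁻¹) := by
  refine ⟨fun hπ => ⟨hπ.strictMonoOn_excedances, hπ.inv.strictMonoOn_excedances⟩, ?_⟩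
  rintro ⟨hexc, hdef⟩ a b c hab hbc hba
  by_contra! hcb
  rcases le_total b (π b) with hb | hb
  · have ha : a ≤ π a := ((hab.trans_le hb).trans hba).le
    exact (hexc ha hb hab).not_gt hba
  · have hb' : π b ∈ excedances π⁻¹ := by simpa [excedances] using hb
    have hc' : π c ∈ excedances π⁻¹ := by
      simpa [excedances] using ((hcb.trans_le hb).trans hbc).le
    have := hdef hc' hb' hcb
    exact this.not_gt (by simpa using hbc)

end Avoidance

theorem cycleType_eq_replicate_iff {α : Type*} [Fintype α] [DecidableEq α] {n p : ℕ}
    [Fact p.Prime] (hα : Fintype.card α = p * n) (π : Equiv.Perm α) :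
    π.cycleType = Multiset.replicate n p ↔ π ^ p = 1 ∧ ∀ x, π x ≠ x := by
  have hsupp : (∀ x, π x ≠ x) ↔ π.cycleType.sum = p * n := by
    rw [Equiv.Perm.sum_cycleType, ← hα, Finset.card_eq_iff_eq_univ, Finset.eq_univ_iff_forall]
    simp only [Equiv.Perm.mem_support]
  rw [hsupp, Equiv.Perm.pow_prime_eq_one_iff]
  constructor
  · intro h
    rw [h]
    exact ⟨fun c hc => Multiset.eq_of_mem_replicate hc, by simp [mul_comm]⟩
  · rintro ⟨hlengths, hsum⟩
    have hrep := Multiset.eq_replicate_card.2 hlengths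
    rw [hrep, Multiset.sum_replicate, smul_eq_mul, mul_comm] at hsum
    rw [hrep, Nat.eq_of_mul_eq_mul_left (Fact.out : p.Prime).pos hsum]

theorem mem_avStar_pattern321_iff {n : ℕ} (π : Equiv.Perm (Fin (3 * n))) :
    π ∈ avStar n pattern321 ↔ (π ^ 3 = 1 ∧ ∀ x, π x ≠ x) ∧ Avoids321 π := by
  rw [← cycleType_eq_replicate_iff (Fintype.card_fin _), ← avoids_pattern321_iff]
  rfl

section Columns

variable {ι α : Type*} {f g : Fin 3 × ι ≃ α} {t u : ι → Bool} {i : ι}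

/-- The permutation whose cycles are the columns of the array `f`: column `i` is rotated from row
`0` to row `1` to row `2` if `t i` holds, and in the opposite direction otherwise. -/
def columnPerm (f : Fin 3 × ι ≃ α) (t : ι → Bool) : Equiv.Perm α :=
  f.permCongr (Equiv.prodCongrLeft fun i => Equiv.addRight (bif t i then 1 else 2))

theorem columnPerm_apply (f : Fin 3 × ι ≃ α) (t : ι → Bool) (l : Fin 3) (i : ι) :
    columnPerm f t (f (l, i)) = f (l + bif t i then 1 else 2, i) := by
  simp [columnPerm, Equiv.permCongr_apply, Equiv.prodCongrLeft]

theorem columnPerm_castSucc_of_true (ht : t i = true) (k : Fin 2) :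
    columnPerm f t (f (k.castSucc, i)) = f (k.succ, i) := by
  rw [columnPerm_apply, ht]
  simp

theorem columnPerm_zero_of_false (ht : t i = false) :
    columnPerm f t (f (0, i)) = f (2, i) := by
  rw [columnPerm_apply, ht]
  rfl

theorem columnPerm_inv (f : Fin 3 × ι ≃ α) (t : ι → Bool) :
    (columnPerm f t)⁻¹ = columnPerm f fun i => !t i := by
  rw [inv_eq_iff_mul_eq_one]
  ext x
  obtain ⟨⟨l, i⟩, rfl⟩ := f.surjective x
  cases ht : t i <;> simp [columnPerm_apply, ht, add_assoc]

theorem columnPerm_pow_three (f : Fin 3 × ι ≃ α) (t : ι → Bool) : columnPerm f t ^ 3 = 1 := by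
  ext x
  obtain ⟨⟨l, i⟩, rfl⟩ := f.surjective x
  cases ht : t i <;> simp [pow_succ, columnPerm_apply, ht, add_assoc]

theorem columnPerm_apply_ne (f : Fin 3 × ι ≃ α) (t : ι → Bool) (x : α) :
    columnPerm f t x ≠ x := by
  obtain ⟨⟨l, i⟩, rfl⟩ := f.surjective x
  cases ht : t i <;> simp [columnPerm_apply, ht]

variable [LinearOrder α]

/-- The points that are the least element of their cycle, for a permutation `π` all of whose cycles
have length three. -/
def cycleMinima (π : Equiv.Perm α) : Set α := {x | x < π x ∧ x < π (π x)}

section Rigidity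

variable (hf : ∀ i, StrictMono fun l => f (l, i))

include hf

theorem range_row_zero (t : ι → Bool) :
    Set.range (fun i => f (0, i)) = cycleMinima (columnPerm f t) := by
  ext x
  obtain ⟨⟨l, i⟩, rfl⟩ := f.surjective x
  have h01 : f (0, i) < f (1, i) := hf i (by decide)
  have h12 : f (1, i) < f (2, i) := hf i (by decide)
  have h02 := h01.trans h12
  fin_cases l <;> cases ht : t i <;>
    simp [cycleMinima, columnPerm_apply, ht, h01, h02, h01.le, h12.le]

theorem row_one_eq_min (t : ι → Bool) (i : ι) :
    f (1, i) =
      min (columnPerm f t (f (0, i))) (columnPerm f t (columnPerm f t (f (0, i)))) := by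
  have h12 : f (1, i) < f (2, i) := hf i (by decide)
  cases ht : t i <;> simp [columnPerm_apply, ht, h12.le]

theorem row_two_eq_max (t : ι → Bool) (i : ι) :
    f (2, i) =
      max (columnPerm f t (f (0, i))) (columnPerm f t (columnPerm f t (f (0, i)))) := by
  have h12 : f (1, i) < f (2, i) := hf i (by decide)
  cases ht : t i <;> simp [columnPerm_apply, ht, h12.le]

theorem orientation_eq_true_iff (t : ι → Bool) (i : ι) :
    t i = true ↔
      columnPerm f t (f (0, i)) < columnPerm f t (columnPerm f t (f (0, i))) := by
  have h12 : f (1, i) < f (2, i) := hf i (by decide)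
  cases ht : t i <;> simp [columnPerm_apply, ht, h12, h12.le]

/-- Row `0` lists the cycle minima in increasing order, and each cycle minimum determines the rest
of its column. -/
theorem columnPerm_injective [LinearOrder ι] [WellFoundedLT ι]
    (hf₀ : StrictMono fun i => f (0, i)) (hg₀ : StrictMono fun i => g (0, i))
    (hg : ∀ i, StrictMono fun l => g (l, i)) (h : columnPerm f t = columnPerm g u) :
    f = g ∧ t = u := by
  have row_zero : (fun i => f (0, i)) = fun i => g (0, i) := by
    rw [← StrictMono.range_inj hf₀ hg₀, range_row_zero hf t, range_row_zero hg u, h]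
  replace row_zero i : f (0, i) = g (0, i) := congrFun row_zero i
  constructor
  · ext ⟨l, i⟩
    have row_one : f (1, i) = g (1, i) := by
      rw [row_one_eq_min hf t, row_one_eq_min hg u, h, row_zero]
    have row_two : f (2, i) = g (2, i) := by
      rw [row_two_eq_max hf t, row_two_eq_max hg u, h, row_zero]
    fin_cases l
    exacts [row_zero i, row_one, row_two]
  · funext i
    rw [Bool.eq_iff_iff, orientation_eq_true_iff hf, orientation_eq_true_iff hg, h, row_zero]

end Rigidity

section Existence

variable {π : Equiv.Perm α}

theorem bijective_pow_cycleMinima (hπ : π ^ 3 = 1) (hfix : ∀ x, π x ≠ x) :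
    Function.Bijective fun x : Fin 3 × cycleMinima π => (π ^ (x.1 : ℕ)) x.2 := by
  have hcube x : π (π (π x)) = x := Equiv.Perm.ext_iff.1 hπ x
  constructor
  · rintro ⟨k, x, hx⟩ ⟨l, y, hy⟩ h
    simp only [cycleMinima, Set.mem_ofPred_eq] at hx hy
    fin_cases k <;> fin_cases l <;> simp [pow_succ] at h ⊢ <;> grind
  · intro z
    have hz : z ∈ cycleMinima π ∨ π z ∈ cycleMinima π ∨ π (π z) ∈ cycleMinima π := by
      simp only [cycleMinima, Set.mem_ofPred_eq]
      grind
    rcases hz with hz | hz | hz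
    · exact ⟨(0, ⟨z, hz⟩), rfl⟩
    · exact ⟨(2, ⟨π z, hz⟩), hcube z⟩
    · exact ⟨(1, ⟨π (π z), hz⟩), hcube z⟩

theorem exists_columnPerm_eq (hπ : π ^ 3 = 1) (hfix : ∀ x, π x ≠ x) :
    ∃ (f : Fin 3 × cycleMinima π ≃ α) (t : cycleMinima π → Bool), columnPerm f t = π ∧
      (∀ x, f (0, x) = x) ∧ ∀ x, StrictMono fun l => f (l, x) := by
  have hcube x : π (π (π x)) = x := Equiv.Perm.ext_iff.1 hπ x
  let orbit := Equiv.ofBijective _ (bijective_pow_cycleMinima hπ hfix)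
  let t : cycleMinima π → Bool := fun x => decide (π x < π (π x))
  let f := (Equiv.prodCongrLeft fun x => bif t x then 1 else Equiv.swap 1 2).trans orbit
  have hf x : f (0, x) = x ∧ (t x = true → f (1, x) = π x ∧ f (2, x) = π (π x)) ∧
      (t x = false → f (1, x) = π (π x) ∧ f (2, x) = π x) := by
    cases ht : t x <;>
      simp [f, orbit, Equiv.prodCongrLeft, ht, pow_succ, Equiv.swap_apply_of_ne_of_ne]
  refine ⟨f, t, ?_, fun x => (hf x).1, fun x => ?_⟩
  · ext z
    obtain ⟨⟨l, x⟩, rfl⟩ := f.surjective z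
    rw [columnPerm_apply]
    cases ht : t x <;> fin_cases l <;> simp [hf, ht, hcube]
  · obtain ⟨hx, hx'⟩ : x < π x ∧ x < π (π x) := x.2
    have hne : π x ≠ π (π x) := (hfix _).symm
    rw [Fin.strictMono_iff_lt_succ, Fin.forall_fin_two]
    cases ht : t x
    · have : π (π x) < π x := (not_lt.1 (by simpa [t] using ht)).lt_of_ne hne.symm
      simp [hf, ht, hx', this]
    · have : π x < π (π x) := by simpa [t] using ht
      simp [hf, ht, hx, this]

theorem exists_fin_columnPerm_eq [Fintype α] {n : ℕ} (hα : Fintype.card α = 3 * n)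
    (hπ : π ^ 3 = 1) (hfix : ∀ x, π x ≠ x) :
    ∃ (f : Fin 3 × Fin n ≃ α) (t : Fin n → Bool), columnPerm f t = π ∧
      (StrictMono fun i => f (0, i)) ∧ ∀ i, StrictMono fun l => f (l, i) := by
  classical
  obtain ⟨f, t, hft, hrow, hcol⟩ := exists_columnPerm_eq hπ hfix
  have hcard : Fintype.card (cycleMinima π) = n := by
    have := Fintype.card_congr f
    rw [Fintype.card_prod, Fintype.card_fin, hα] at this
    omega
  let e := Fintype.orderIsoFinOfCardEq _ hcard
  refine ⟨((Equiv.refl _).prodCongr e.toEquiv).trans f, t ∘ e, ?_, ?_, fun i => hcol (e i)⟩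
  · ext x
    obtain ⟨⟨l, i⟩, rfl⟩ := (((Equiv.refl _).prodCongr e.toEquiv).trans f).surjective x
    refine (columnPerm_apply _ _ l i).trans ?_
    simpa [columnPerm_apply] using DFunLike.congr_fun hft (f (l, e i))
  · intro i j hij
    simpa [hrow] using hij

end Existence

theorem mem_excedances_columnPerm_iff (hf : ∀ i, StrictMono fun l => f (l, i)) {x : α} :
    x ∈ excedances (columnPerm f t) ↔
      (∃ i, ∃ k : Fin 2, t i = true ∧ x = f (k.castSucc, i)) ∨
        ∃ i, t i = false ∧ x = f (0, i) := by
  constructor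
  · obtain ⟨⟨l, i⟩, rfl⟩ := f.surjective x
    intro hx
    rw [excedances, Set.mem_ofPred_eq, columnPerm_apply, (hf i).le_iff_le] at hx
    cases ht : t i
    · exact .inr ⟨i, ht, by grind⟩
    · exact .inl ⟨i, l.castPred (by grind), ht, by simp⟩
  · rintro (⟨i, k, ht, rfl⟩ | ⟨i, ht, rfl⟩)
    · exact (hf i k.castSucc_lt_succ).le.trans_eq (columnPerm_castSucc_of_true ht k).symm
    · exact (hf i (by decide : (0 : Fin 3) < 2)).le.trans_eq (columnPerm_zero_of_false ht).symm

section Arrangements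

variable [LinearOrder ι]

/-- An array with increasing rows and columns whose rows `0`, `1` are interleaved in the same way as
its rows `1`, `2`. These are the arrays of sorted cycles of the permutations we count. -/
structure IsArrangement (f : Fin 3 × ι ≃ α) : Prop where
  row_strictMono : ∀ l, StrictMono fun i => f (l, i)
  col_strictMono : ∀ i, StrictMono fun l => f (l, i)
  lt_iff : ∀ i j, f (1, i) < f (0, j) ↔ f (2, i) < f (1, j)

/-- A choice of rotation directions for the columns of an array, where two columns may get different
directions only if rows `1` and `2` of the left one lie below rows `1` and `2` of the right one. -/
def IsOrientation (f : Fin 3 × ι ≃ α) (t : ι → Bool) : Prop :=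
  ∀ i j, i < j → t i ≠ t j → f (2, i) < f (1, j)

theorem IsOrientation.not (ht : IsOrientation f t) : IsOrientation f fun i => !t i :=
  fun i j hij hne => ht i j hij (by simpa using hne)

theorem IsArrangement.succ_lt_succ (hf : IsArrangement f) {k l : Fin 2} {i j : ι}
    (h : f (k.castSucc, i) < f (l.castSucc, j)) : f (k.succ, i) < f (l.succ, j) := by
  obtain rfl | rfl : k = 0 ∨ k = 1 := by omega
  all_goals obtain rfl | rfl : l = 0 ∨ l = 1 := by omega
  · exact hf.row_strictMono 1 ((hf.row_strictMono 0).lt_iff_lt.1 h)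
  · have hle : f (1, i) ≤ f (2, j) := not_lt.1 fun hlt => h.not_gt ((hf.lt_iff j i).2 hlt)
    exact hle.lt_of_ne (f.injective.ne (by simp))
  · exact (hf.lt_iff i j).1 h
  · exact hf.row_strictMono 2 ((hf.row_strictMono 1).lt_iff_lt.1 h)

theorem IsArrangement.strictMonoOn_excedances (hf : IsArrangement f) (ht : IsOrientation f t) :
    StrictMonoOn (columnPerm f t) (excedances (columnPerm f t)) := by
  intro x hx y hy hxy
  rw [mem_excedances_columnPerm_iff hf.col_strictMono] at hx hy
  obtain ⟨i, k, hi, rfl⟩ | ⟨i, hi, rfl⟩ := hx <;>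
  obtain ⟨j, l, hj, rfl⟩ | ⟨j, hj, rfl⟩ := hy
  · simpa only [columnPerm_castSucc_of_true, hi, hj] using hf.succ_lt_succ hxy
  · rw [columnPerm_castSucc_of_true hi, columnPerm_zero_of_false hj]
    have hij : i < j := (hf.row_strictMono 0).lt_iff_lt.1 <|
      ((hf.col_strictMono i).monotone (Fin.zero_le _)).trans_lt hxy
    exact ((hf.col_strictMono i).monotone (Fin.le_last _)).trans_lt (hf.row_strictMono 2 hij)
  · rw [columnPerm_zero_of_false hi, columnPerm_castSucc_of_true hj]
    have hl : l.castSucc ≤ 1 ∧ 1 ≤ l.succ := by fin_cases l <;> simp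
    have hij : i < j := by
      by_contra! hji
      have hji : j < i := hji.lt_of_ne fun e => by simp [e, hi] at hj
      have hlt : f (1, j) < f (0, i) := (hf.lt_iff j i).2 (ht j i hji (by simp [hi, hj]))
      have hle : f (l.castSucc, j) ≤ f (1, j) := (hf.col_strictMono j).monotone hl.1
      exact (hle.trans_lt hlt).not_gt hxy
    exact (ht i j hij (by simp [hi, hj])).trans_le ((hf.col_strictMono j).monotone hl.2)
  · rw [columnPerm_zero_of_false hi, columnPerm_zero_of_false hj]
    exact hf.row_strictMono 2 ((hf.row_strictMono 0).lt_iff_lt.1 hxy)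

theorem IsArrangement.avoids321_columnPerm [Finite α] (hf : IsArrangement f)
    (ht : IsOrientation f t) : Avoids321 (columnPerm f t) := by
  rw [avoids321_iff_strictMonoOn_excedances, columnPerm_inv]
  exact ⟨hf.strictMonoOn_excedances ht, hf.strictMonoOn_excedances ht.not⟩

/-- Inversion reverses all the directions, so only two of the four pairs of directions have to be
inspected. -/
theorem Avoids321.columns_compatible [Finite α] (hπ : Avoids321 (columnPerm f t))
    (hcol : ∀ i, StrictMono fun l => f (l, i)) (hrow : StrictMono fun i => f (0, i)) {i j : ι}
    (hij : i < j) :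
    f (1, i) < f (1, j) ∧ f (2, i) < f (2, j) ∧ (f (1, i) < f (0, j) ↔ f (2, i) < f (1, j)) ∧
      (t i ≠ t j → f (2, i) < f (1, j)) := by
  wlog hi : t i = true generalizing t
  · have := this (t := fun i => !t i) (by rw [← columnPerm_inv]; exact hπ.inv) (by simpa using hi)
    simpa using this
  have mem_up {u : ι → Bool} {i} (hu : u i = true) (k : Fin 2) :
      f (k.castSucc, i) ∈ excedances (columnPerm f u) :=
    (mem_excedances_columnPerm_iff hcol).2 (.inl ⟨i, k, hu, rfl⟩)
  have mem_down {u : ι → Bool} {i} (hu : u i = false) : f (0, i) ∈ excedances (columnPerm f u) :=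
    (mem_excedances_columnPerm_iff hcol).2 (.inr ⟨i, hu, rfl⟩)
  have hmono := hπ.strictMonoOn_excedances
  cases hj : t j
  · have h21 : f (2, i) < f (1, j) := by
      have hinv := hπ.inv.strictMonoOn_excedances
      rw [columnPerm_inv] at hinv
      have hi' : (fun i => !t i) i = false := by simp [hi]
      have hj' : (fun i => !t i) j = true := by simp [hj]
      have := hinv (mem_down hi') (mem_up hj' 0) (hrow hij)
      rwa [columnPerm_zero_of_false (t := fun i => !t i) hi',
        columnPerm_castSucc_of_true (t := fun i => !t i) hj'] at this
    have h22 : f (2, i) < f (2, j) := h21.trans (hcol j (by decide))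
    have h10 : f (1, i) < f (0, j) := by
      refine (hmono.lt_iff_lt (mem_up hi 1) (mem_down hj)).1 ?_
      rwa [columnPerm_castSucc_of_true hi, columnPerm_zero_of_false hj]
    have h11 : f (1, i) < f (1, j) := h10.trans (hcol j (by decide))
    exact ⟨h11, h22, iff_of_true h10 h21, fun _ => h21⟩
  · have hsucc (k l : Fin 2) :
        f (k.castSucc, i) < f (l.castSucc, j) ↔ f (k.succ, i) < f (l.succ, j) := by
      rw [← hmono.lt_iff_lt (mem_up hi k) (mem_up hj l), columnPerm_castSucc_of_true hi,
        columnPerm_castSucc_of_true hj]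
    have h11 : f (1, i) < f (1, j) := (hsucc 0 0).1 (hrow hij)
    exact ⟨h11, (hsucc 1 1).1 h11, hsucc 1 0, fun hne => absurd hi hne⟩

theorem Avoids321.isArrangement [Finite α] (hπ : Avoids321 (columnPerm f t))
    (hcol : ∀ i, StrictMono fun l => f (l, i)) (hrow : StrictMono fun i => f (0, i)) :
    IsArrangement f where
  row_strictMono l := by
    fin_cases l
    · exact hrow
    · exact fun i j hij => (hπ.columns_compatible hcol hrow hij).1
    · exact fun i j hij => (hπ.columns_compatible hcol hrow hij).2.1
  col_strictMono := hcol
  lt_iff i j := by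
    rcases lt_or_ge i j with hij | hji
    · exact (hπ.columns_compatible hcol hrow hij).2.2.1
    · have h01 : f (0, j) < f (1, i) := (hrow.monotone hji).trans_lt (hcol i (by decide))
      have h12 : f (1, j) < f (2, i) := by
        rcases hji.eq_or_lt with rfl | hji
        · exact hcol j (by decide)
        · exact (hπ.columns_compatible hcol hrow hji).1.trans (hcol i (by decide))
      exact iff_of_false h01.not_gt h12.not_gt

theorem Avoids321.isOrientation [Finite α] (hπ : Avoids321 (columnPerm f t))
    (hcol : ∀ i, StrictMono fun l => f (l, i)) (hrow : StrictMono fun i => f (0, i)) :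
    IsOrientation f t :=
  fun _ _ hij => (hπ.columns_compatible hcol hrow hij).2.2.2

end Arrangements

end Columns

theorem ncard_avStar_pattern321 (n : ℕ) :
    (avStar n pattern321).ncard =
      Nat.card (Σ f : {f : Fin 3 × Fin n ≃ Fin (3 * n) // IsArrangement f},
        {t : Fin n → Bool // IsOrientation f.1 t}) := by
  rw [← Nat.card_coe_set_eq]
  symm
  refine Nat.card_eq_of_bijective (fun x => ⟨columnPerm x.1.1 x.2.1, ?_⟩) ⟨?_, ?_⟩
  · exact (mem_avStar_pattern321_iff _).2
      ⟨⟨columnPerm_pow_three _ _, columnPerm_apply_ne _ _⟩, x.1.2.avoids321_columnPerm x.2.2⟩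
  · rintro ⟨⟨f, hf⟩, t, ht⟩ ⟨⟨g, hg⟩, u, hu⟩ e
    obtain ⟨rfl, rfl⟩ := columnPerm_injective hf.col_strictMono (hf.row_strictMono 0)
      (hg.row_strictMono 0) hg.col_strictMono (congrArg Subtype.val e)
    rfl
  · rintro ⟨π, hπ⟩
    obtain ⟨⟨hcube, hfix⟩, havoid⟩ := (mem_avStar_pattern321_iff π).1 hπ
    obtain ⟨f, t, rfl, hrow, hcol⟩ := exists_fin_columnPerm_eq (Fintype.card_fin _) hcube hfix
    exact ⟨⟨⟨f, havoid.isArrangement hcol hrow⟩, t, havoid.isOrientation hcol hrow⟩, rfl⟩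

section Precedes

variable {κ : Type*} [DecidableEq κ] {w : List κ} {x y : κ} {i j : ℕ}

/-- The `i`-th letter `x` of `w` exists and stands before the `j`-th letter `y` of `w`, if any.
Occurrences are numbered from `0`. -/
def Precedes (w : List κ) (x : κ) (i : ℕ) (y : κ) (j : ℕ) : Prop :=
  ∃ q, q <+: w ∧ i < q.count x ∧ q.count y ≤ j

theorem precedes_cons_iff {z : κ} :
    Precedes (z :: w) x i y j ↔ ∃ q, q <+: w ∧ i < (z :: q).count x ∧ (z :: q).count y ≤ j := by
  constructor
  · rintro ⟨q, hq, hx, hy⟩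
    obtain rfl | ⟨t, rfl, ht⟩ := List.prefix_cons_iff.1 hq
    · simp at hx
    · exact ⟨t, ht, hx, hy⟩
  · rintro ⟨q, hq, hx, hy⟩
    exact ⟨z :: q, by simpa using hq, hx, hy⟩

theorem precedes_cons_left_zero (hxy : x ≠ y) : Precedes (x :: w) x 0 y j :=
  precedes_cons_iff.2 ⟨[], by simp [hxy]⟩

theorem not_precedes_cons_right_zero : ¬ Precedes (y :: w) x i y 0 := by
  simp [precedes_cons_iff]

theorem precedes_cons_left_succ (hxy : x ≠ y) :
    Precedes (x :: w) x (i + 1) y j ↔ Precedes w x i y j := by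
  rw [precedes_cons_iff]
  simp [Precedes, hxy]

theorem precedes_cons_right_succ (hxy : x ≠ y) :
    Precedes (y :: w) x i y (j + 1) ↔ Precedes w x i y j := by
  rw [precedes_cons_iff]
  simp [Precedes, hxy.symm]

theorem count_filterMap_of_iff {κ' : Type*} [DecidableEq κ'] {g : κ → Option κ'} {b : κ'}
    (hg : ∀ a, g a = some b ↔ a = x) (w : List κ) : (w.filterMap g).count b = w.count x := by
  rw [List.count_filterMap, List.count]
  congr 1
  funext a
  rw [Bool.eq_iff_iff, beq_iff_eq, beq_iff_eq, hg]

theorem precedes_filterMap_iff {κ' : Type*} [DecidableEq κ'] {g : κ → Option κ'} {b c : κ'}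
    (hb : ∀ a, g a = some b ↔ a = x) (hc : ∀ a, g a = some c ↔ a = y) :
    Precedes (w.filterMap g) b i c j ↔ Precedes w x i y j := by
  constructor
  · rintro ⟨_, hq, hx, hy⟩
    obtain ⟨q, hqw, rfl⟩ := List.prefix_filterMap_iff.1 hq
    rw [count_filterMap_of_iff hb] at hx
    rw [count_filterMap_of_iff hc] at hy
    exact ⟨q, hqw, hx, hy⟩
  · rintro ⟨q, hq, hx, hy⟩
    exact ⟨_, hq.filterMap g, by rwa [count_filterMap_of_iff hb],
      by rwa [count_filterMap_of_iff hc]⟩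

end Precedes

section DyckWords

variable {p : DyckWord} {q : List DyckStep} {i : ℕ}

theorem eq_of_forall_precedes_iff {u v : List DyckStep} (hU : u.count U = v.count U)
    (hD : u.count D = v.count D)
    (h : ∀ i < u.count D, ∀ j < u.count U, Precedes u D i U j ↔ Precedes v D i U j) : u = v := by
  induction u generalizing v with
  | nil => rcases v with _ | ⟨_ | _, v⟩ <;> simp at hU hD ⊢
  | cons z u ih =>
    have hDU : D ≠ U := by decide
    rcases z with _ | _ <;> rcases v with _ | ⟨_ | _, v⟩ <;>
      simp only [List.count_cons_self, List.count_cons_of_ne, List.count_nil, ne_eq, reduceCtorEq,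
        not_false_eq_true, Nat.add_right_cancel_iff, Nat.add_one_ne_zero] at hU hD h
    · rw [ih hU hD fun i hi j hj => ?_]
      simpa only [precedes_cons_right_succ hDU] using h i hi (j + 1) (by omega)
    · exact absurd ((h 0 (by omega) 0 (by omega)).2 (precedes_cons_left_zero hDU))
        not_precedes_cons_right_zero
    · exact absurd ((h 0 (by omega) 0 (by omega)).1 (precedes_cons_left_zero hDU))
        not_precedes_cons_right_zero
    · rw [ih hU hD fun i hi j hj => ?_]
      simpa only [precedes_cons_left_succ hDU] using h (i + 1) (by omega) j hj

theorem count_U_add_count_D (w : List DyckStep) : w.count U + w.count D = w.length := by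
  induction w with
  | nil => rfl
  | cons z w ih => cases z <;> simp <;> omega

theorem count_D_le_count_U_of_prefix (hq : q <+: p.toList) : q.count D ≤ q.count U := by
  rw [List.prefix_iff_eq_take.1 hq]
  exact p.count_D_le_count_U _

theorem not_precedes_self (p : DyckWord) (i : ℕ) : ¬ Precedes p.toList D i U i := by
  rintro ⟨q, hq, hD, hU⟩
  have := count_D_le_count_U_of_prefix hq
  omega

theorem precedes_succ_iff :
    Precedes p.toList D i U (i + 1) ↔
      2 * (i + 1) ≤ p.toList.length ∧
        (p.toList.take (2 * (i + 1))).count U = (p.toList.take (2 * (i + 1))).count D := by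
  constructor
  · rintro ⟨q, hq, hD, hU⟩
    have hle := count_D_le_count_U_of_prefix hq
    have hlen : q.length = 2 * (i + 1) := by
      rw [← count_U_add_count_D]
      omega
    rw [← hlen, ← List.prefix_iff_eq_take.1 hq]
    exact ⟨hq.length_le, by omega⟩
  · rintro ⟨hle, heq⟩
    have hlen := count_U_add_count_D (p.toList.take (2 * (i + 1)))
    rw [List.length_take, min_eq_left hle] at hlen
    exact ⟨p.toList.take (2 * (i + 1)), List.take_prefix _ _, by omega, by omega⟩

theorem precedes_last (p : DyckWord) {n : ℕ} (hp : p.semilength = n + 1) :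
    Precedes p.toList D n U (n + 1) :=
  ⟨p.toList, List.prefix_rfl, by rw [← p.semilength_eq_count_D]; omega, hp.le⟩

open Classical in
theorem h_eq_card (p : DyckWord) :
    h p = ((Finset.range p.semilength).filter
      fun i => Precedes p.toList D i U (i + 1)).card := by
  symm
  refine Finset.card_nbij (fun i => 2 * (i + 1)) (fun i hi => ?_) (by intro; grind) fun k hk => ?_
  · rw [Finset.mem_coe, Finset.mem_filter, precedes_succ_iff] at hi
    exact Finset.mem_filter.2 ⟨Finset.mem_Icc.2 ⟨Nat.mul_pos two_pos i.succ_pos, hi.2.1⟩, hi.2.2⟩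
  · simp only [Finset.coe_filter, Finset.mem_Icc, Set.mem_ofPred_eq] at hk
    obtain ⟨⟨hk₀, hk⟩, heq⟩ := hk
    have hlen := count_U_add_count_D (p.toList.take k)
    rw [List.length_take, min_eq_left hk] at hlen
    obtain ⟨i, rfl⟩ : ∃ i, k = 2 * (i + 1) := ⟨k / 2 - 1, by omega⟩
    refine ⟨i, ?_, rfl⟩
    have := p.two_mul_semilength_eq_length
    simpa [precedes_succ_iff, hk, heq] using (by omega : i < p.semilength)

end DyckWords

open Classical in
theorem card_colorings_eq_pow {n : ℕ} (β : Type*) (P : Fin n → Prop) :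
    Nat.card {t : Fin (n + 1) → β // ∀ i : Fin n, ¬ P i → t i.castSucc = t i.succ} =
      Nat.card β ^ ((Finset.univ.filter P).card + 1) := by
  induction n with
  | zero => simpa using Nat.card_congr (Equiv.funUnique (Fin 1) β)
  | succ n ih =>
    rw [Fin.card_filter_univ_succ]
    simp only [Fin.forall_fin_succ (n := n), Fin.castSucc_zero, ← Fin.succ_castSucc]
    split_ifs with h0
    · rw [pow_succ', ← ih, ← Nat.card_prod]
      refine Nat.card_eq_of_bijective (fun t => (t.1 0, ⟨Fin.tail t.1, t.2.2⟩)) ⟨?_, ?_⟩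
      · rintro ⟨t, ht⟩ ⟨u, hu⟩ htu
        have hzero : t 0 = u 0 := congrArg Prod.fst htu
        have htail : Fin.tail t = Fin.tail u := congrArg (fun x => x.2.1) htu
        rw [Subtype.mk.injEq, ← Fin.cons_self_tail t, hzero, htail, Fin.cons_self_tail]
      · rintro ⟨b, t, ht⟩
        exact ⟨⟨Fin.cons b t, by simp [h0], ht⟩, rfl⟩
    · rw [← ih]
      refine Nat.card_eq_of_bijective (fun t => ⟨Fin.tail t.1, t.2.2⟩) ⟨?_, ?_⟩
      · rintro ⟨t, ht⟩ ⟨u, hu⟩ htu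
        have htail : Fin.tail t = Fin.tail u := congrArg Subtype.val htu
        have hzero : t 0 = u 0 := (ht.1 h0).trans ((congrFun htail 0).trans (hu.1 h0).symm)
        rw [Subtype.mk.injEq, ← Fin.cons_self_tail t, hzero, htail, Fin.cons_self_tail]
      · rintro ⟨t, ht⟩
        exact ⟨⟨Fin.cons (t 0) t, by simp, ht⟩, rfl⟩

section Gaps

variable {w : List DyckStep} {a b z : DyckStep} {i : ℕ}

theorem between_nil (a b : DyckStep) (i : ℕ) : between [] a b i = 0 := by
  simp [between]

theorem between_cons (z : DyckStep) (w : List DyckStep) (a b : DyckStep) (i : ℕ) :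
    between (z :: w) a b i = (if z = b ∧ i = 0 then 1 else 0) +
      (if z = a then (if i = 0 then 0 else between w a b (i - 1)) else between w a b i) := by
  unfold between
  refine (Fin.card_filter_univ_succ' _).trans ?_
  congr 1
  · simp [eq_comm]
  · by_cases hz : z = a
    · rcases i with _ | i <;> simp [hz]
    · simp [hz]

theorem between_zero_of_head_ne (hab : a ≠ b) (hw : w.head? ≠ some b) : between w a b 0 = 0 := by
  cases w with
  | nil => exact between_nil _ _ _
  | cons z w =>
    have hzb : z ≠ b := by simpa using hw
    have hza : z = a := by cases z <;> cases a <;> cases b <;> simp_all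
    simp [between_cons, hza, hab]

theorem between_cons_succ (hza : z ≠ a) : between (z :: w) a z (i + 1) = between w a z (i + 1) := by
  simp [between_cons, hza]

theorem between_cons_zero (hza : z ≠ a) : between (z :: w) a z 0 = between w a z 0 + 1 := by
  simp [between_cons, hza, add_comm]

theorem between_eq_zero (hw : ∀ q, q ++ [b] <+: w → q.count a ≠ i) : between w a b i = 0 := by
  rw [between, Finset.card_eq_zero, Finset.filter_eq_empty_iff]
  rintro k - ⟨hb, ha⟩
  refine hw (w.take k) ?_ ha
  rw [← hb, List.get_eq_getElem, List.take_append_getElem]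
  exact List.take_prefix _ _

theorem between_U_D_zero (p : DyckWord) : between p.toList U D 0 = 0 := by
  refine between_eq_zero fun q hq => ?_
  have hDU : q.count D + 1 ≤ q.count U := by simpa using count_D_le_count_U_of_prefix hq
  omega

theorem between_D_U_semilength (p : DyckWord) : between p.toList D U p.semilength = 0 := by
  refine between_eq_zero fun q hq => ?_
  have hDU : q.count D ≤ q.count U :=
    count_D_le_count_U_of_prefix ((List.prefix_append _ _).trans hq)
  have hU : q.count U + 1 ≤ p.semilength := by
    simpa using! hq.sublist.count_le U
  omega

end Gaps

section Shuffles

variable {u v : List DyckStep} {w : List (Fin 3)} {i j : ℕ}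

/-- Rows `0` and `1`, read as the letters `U` and `D`. -/
def lowerStep : Fin 3 → Option DyckStep := ![some U, some D, none]

/-- Rows `1` and `2`, read as the letters `U` and `D`. -/
def upperStep : Fin 3 → Option DyckStep := ![none, some U, some D]

theorem count_U_lowerStep (w : List (Fin 3)) : (w.filterMap lowerStep).count U = w.count 0 :=
  count_filterMap_of_iff (by decide) w

theorem count_D_lowerStep (w : List (Fin 3)) : (w.filterMap lowerStep).count D = w.count 1 :=
  count_filterMap_of_iff (by decide) w

theorem count_U_upperStep (w : List (Fin 3)) : (w.filterMap upperStep).count U = w.count 1 :=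
  count_filterMap_of_iff (by decide) w

theorem count_D_upperStep (w : List (Fin 3)) : (w.filterMap upperStep).count D = w.count 2 :=
  count_filterMap_of_iff (by decide) w

theorem precedes_lowerStep : Precedes (w.filterMap lowerStep) D i U j ↔ Precedes w 1 i 0 j :=
  precedes_filterMap_iff (by decide) (by decide)

theorem precedes_upperStep : Precedes (w.filterMap upperStep) D i U j ↔ Precedes w 2 i 1 j :=
  precedes_filterMap_iff (by decide) (by decide)

/-- The words in three letters whose letters `0, 1` spell `u` and whose letters `1, 2` spell `v`,
that is, the shuffles of `u` and `v` in which each `D` of `u` is merged with a `U` of `v`. -/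
def shuffles (u v : List DyckStep) : Set (List (Fin 3)) :=
  {w | w.filterMap lowerStep = u ∧ w.filterMap upperStep = v}

theorem finite_shuffles (u v : List DyckStep) : (shuffles u v).Finite := by
  refine (List.finite_length_le (Fin 3) (u.length + v.length)).subset ?_
  rintro w ⟨rfl, rfl⟩
  induction w with
  | nil => simp
  | cons a w ih =>
    fin_cases a <;> simp [List.filterMap_cons, lowerStep, upperStep] at ih ⊢ <;> omega

theorem nil_mem_shuffles : [] ∈ shuffles u v ↔ u = [] ∧ v = [] := by
  simp [shuffles, eq_comm]

theorem zero_cons_mem_shuffles : 0 :: w ∈ shuffles u v ↔ ∃ u', u = U :: u' ∧ w ∈ shuffles u' v := by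
  simp only [shuffles, Set.mem_ofPred_eq, List.filterMap_cons, lowerStep, upperStep,
    Matrix.cons_val]
  grind

theorem one_cons_mem_shuffles :
    1 :: w ∈ shuffles u v ↔ ∃ u' v', u = D :: u' ∧ v = U :: v' ∧ w ∈ shuffles u' v' := by
  simp only [shuffles, Set.mem_ofPred_eq, List.filterMap_cons, lowerStep, upperStep,
    Matrix.cons_val]
  grind

theorem two_cons_mem_shuffles : 2 :: w ∈ shuffles u v ↔ ∃ v', v = D :: v' ∧ w ∈ shuffles u v' := by
  simp only [shuffles, Set.mem_ofPred_eq, List.filterMap_cons, lowerStep, upperStep,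
    Matrix.cons_val]
  grind

theorem shuffles_nil_nil : shuffles [] [] = {[]} := by
  ext (_ | ⟨a, w⟩)
  · simp [nil_mem_shuffles]
  · fin_cases a <;> simp [zero_cons_mem_shuffles, one_cons_mem_shuffles, two_cons_mem_shuffles]

theorem shuffles_U_cons (hv : v.head? ≠ some D) :
    shuffles (U :: u) v = List.cons 0 '' shuffles u v := by
  have hv' v' : v ≠ D :: v' := by rintro rfl; simp at hv
  ext (_ | ⟨a, w⟩)
  · simp [nil_mem_shuffles]
  · fin_cases a <;>
      simp [zero_cons_mem_shuffles, one_cons_mem_shuffles, two_cons_mem_shuffles, hv']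

theorem shuffles_D_cons (hu : u.head? ≠ some U) :
    shuffles u (D :: v) = List.cons 2 '' shuffles u v := by
  have hu' u' : u ≠ U :: u' := by rintro rfl; simp at hu
  ext (_ | ⟨a, w⟩)
  · simp [nil_mem_shuffles]
  · fin_cases a <;>
      simp [zero_cons_mem_shuffles, one_cons_mem_shuffles, two_cons_mem_shuffles, hu']

theorem shuffles_D_cons_U_cons : shuffles (D :: u) (U :: v) = List.cons 1 '' shuffles u v := by
  ext (_ | ⟨a, w⟩)
  · simp [nil_mem_shuffles]
  · fin_cases a <;> simp [zero_cons_mem_shuffles, one_cons_mem_shuffles, two_cons_mem_shuffles]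

theorem shuffles_U_cons_D_cons :
    shuffles (U :: u) (D :: v) =
      List.cons 0 '' shuffles u (D :: v) ∪ List.cons 2 '' shuffles (U :: u) v := by
  ext (_ | ⟨a, w⟩)
  · simp [nil_mem_shuffles]
  · fin_cases a <;> simp [zero_cons_mem_shuffles, one_cons_mem_shuffles, two_cons_mem_shuffles]

/-- The product, over the gaps between consecutive merged letters, of the number of ways to
interleave the letters `U` of `u` with the letters `D` of `v` in that gap.
It counts `shuffles u v`. -/
def gapProduct (u v : List DyckStep) : ℕ :=
  ∏ i ∈ Finset.range (u.count D + 1),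
    (between v U D i + between u D U i).choose (between v U D i)

theorem gapProduct_U_cons (hv : v.head? ≠ some D) : gapProduct (U :: u) v = gapProduct u v := by
  simp [gapProduct, Finset.prod_range_succ', between_cons_succ,
    between_zero_of_head_ne (by decide : U ≠ D) hv]

theorem gapProduct_D_cons (hu : u.head? ≠ some U) : gapProduct u (D :: v) = gapProduct u v := by
  simp [gapProduct, Finset.prod_range_succ', between_cons_succ,
    between_zero_of_head_ne (by decide : D ≠ U) hu]

theorem gapProduct_D_cons_U_cons (u v : List DyckStep) :
    gapProduct (D :: u) (U :: v) = gapProduct u v := by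
  simp [gapProduct, Finset.prod_range_succ', between_cons]

/-- Only the initial gap is affected, and there this is Pascal's rule. -/
theorem gapProduct_U_cons_D_cons (u v : List DyckStep) :
    gapProduct (U :: u) (D :: v) = gapProduct u (D :: v) + gapProduct (U :: u) v := by
  simp only [gapProduct, Finset.prod_range_succ', between_cons_succ, between_cons_zero,
    ne_eq, reduceCtorEq, not_false_eq_true, List.count_cons_of_ne]
  rw [← mul_add, ← add_assoc, Nat.choose_succ_succ, add_comm (Nat.choose _ _), add_right_comm]
  rfl

theorem ncard_shuffles (u v : List DyckStep) (huv : u.count D = v.count U) :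
    (shuffles u v).ncard = gapProduct u v := by
  have ncard_cons a (s : Set (List (Fin 3))) : (List.cons a '' s).ncard = s.ncard :=
    Set.ncard_image_of_injective _ List.cons_injective
  match u, v with
  | [], [] => simp [shuffles_nil_nil, gapProduct, between_nil]
  | [], U :: v => simp at huv
  | D :: u, [] => simp at huv
  | U :: u, [] | U :: u, U :: v =>
    rw [shuffles_U_cons (by simp), gapProduct_U_cons (by simp), ncard_cons,
      ncard_shuffles _ _ (by simpa using huv)]
  | [], D :: v | D :: u, D :: v =>
    rw [shuffles_D_cons (by simp), gapProduct_D_cons (by simp), ncard_cons,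
      ncard_shuffles _ _ (by simpa using huv)]
  | D :: u, U :: v =>
    rw [shuffles_D_cons_U_cons, gapProduct_D_cons_U_cons, ncard_cons,
      ncard_shuffles _ _ (by simpa using huv)]
  | U :: u, D :: v =>
    have hdisj : Disjoint (List.cons 0 '' shuffles u (D :: v))
        (List.cons 2 '' shuffles (U :: u) v) := by
      rw [Set.disjoint_left]
      rintro _ ⟨w, -, rfl⟩ ⟨w', -, e⟩
      simp at e
    rw [shuffles_U_cons_D_cons, gapProduct_U_cons_D_cons,
      Set.ncard_union_eq hdisj ((finite_shuffles _ _).image _) ((finite_shuffles _ _).image _),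
      ncard_cons, ncard_cons, ncard_shuffles _ _ (by simpa using huv),
      ncard_shuffles _ _ (by simpa using huv)]
termination_by u.length + v.length

theorem gapProduct_self (p : DyckWord) :
    gapProduct p.toList p.toList =
      ∏ i ∈ Finset.Icc 1 (p.semilength - 1), (r p i + s p i).choose (r p i) := by
  rw [gapProduct, ← p.semilength_eq_count_D]
  refine (Finset.prod_subset (fun i hi => ?_) fun i hi hi' => ?_).symm
  · grind
  · obtain rfl | rfl : i = 0 ∨ i = p.semilength := by grind
    · simp [between_U_D_zero]
    · simp [between_D_U_semilength]

end Shuffles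

section RowWords

variable {κ : Type*} [DecidableEq κ] {m n : ℕ}

theorem count_take_ofFn (g : Fin m → κ) (a : κ) (k : ℕ) :
    ((List.ofFn g).take k).count a =
      (Finset.univ.filter fun q : Fin m => (q : ℕ) < k ∧ g q = a).card := by
  induction m generalizing k with
  | zero => simp
  | succ m ih =>
    cases k with
    | zero => simp
    | succ k =>
      rw [List.ofFn_succ, List.take_succ_cons, List.count_cons, ih, Fin.card_filter_univ_succ']
      simp [add_comm]

/-- The word recording the row of each position in an array of the numbers `0, …, m - 1`. -/
def rowWord (f : κ × Fin n ≃ Fin m) : List κ :=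
  List.ofFn fun q => (f.symm q).1

theorem count_take_rowWord (f : κ × Fin n ≃ Fin m) (l : κ) (k : ℕ) :
    ((rowWord f).take k).count l =
      (Finset.univ.filter fun i : Fin n => (f (l, i) : ℕ) < k).card := by
  rw [rowWord, count_take_ofFn]
  symm
  refine Finset.card_nbij (fun i => f (l, i)) (fun i hi => by simpa using hi) ?_ fun q hq => ?_
  · intro i _ j _ hij
    simpa using hij
  · obtain ⟨⟨l', i⟩, rfl⟩ := f.surjective q
    obtain ⟨hik, rfl⟩ : (f (l', i) : ℕ) < k ∧ l' = l := by simpa using hq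
    exact ⟨i, by simpa using hik, rfl⟩

theorem count_rowWord (f : κ × Fin n ≃ Fin m) (l : κ) : (rowWord f).count l = n := by
  have := count_take_rowWord f l m
  rw [List.take_of_length_le (by simp [rowWord])] at this
  simpa using this

theorem lt_count_take_rowWord {f : κ × Fin n ≃ Fin m} {l : κ}
    (hf : StrictMono fun i => f (l, i)) (i : Fin n) (k : ℕ) :
    (i : ℕ) < ((rowWord f).take k).count l ↔ (f (l, i) : ℕ) < k := by
  rw [count_take_rowWord]
  exact Tuple.lt_card_lt_iff_apply_lt_of_monotone (f := fun i => (f (l, i) : ℕ)) hf.monotone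

variable {f g : κ × Fin n ≃ Fin m}

theorem precedes_rowWord_iff (hf : ∀ l, StrictMono fun i => f (l, i)) (l l' : κ) (i j : Fin n) :
    Precedes (rowWord f) l i l' j ↔ f (l, i) < f (l', j) := by
  constructor
  · rintro ⟨q, hq, hi, hj⟩
    rw [List.prefix_iff_eq_take.1 hq] at hi hj
    rw [lt_count_take_rowWord (hf l)] at hi
    rw [← not_lt, lt_count_take_rowWord (hf l')] at hj
    exact Fin.lt_def.2 (hi.trans_le (not_lt.1 hj))
  · intro hlt
    refine ⟨(rowWord f).take (f (l', j)), List.take_prefix _ _, ?_, ?_⟩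
    · exact (lt_count_take_rowWord (hf l) _ _).2 hlt
    · rw [← not_lt, lt_count_take_rowWord (hf l')]
      exact lt_irrefl _

omit [DecidableEq κ] in
theorem eq_of_rowWord_eq (hf : ∀ l, StrictMono fun i => f (l, i))
    (hg : ∀ l, StrictMono fun i => g (l, i)) (h : rowWord f = rowWord g) : f = g := by
  classical
  ext ⟨l, i⟩
  refine eq_of_forall_gt_iff fun k => ?_
  rw [← lt_count_take_rowWord (hf l), ← lt_count_take_rowWord (hg l), h]

theorem exists_rowWord_eq {w : List κ} (hm : w.length = m) (hw : ∀ l, w.count l = n) :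
    ∃ f : κ × Fin n ≃ Fin m, (∀ l, StrictMono fun i => f (l, i)) ∧ rowWord f = w := by
  subst hm
  have hcard l : (Finset.univ.filter fun q => w.get q = l).card = n := by
    simpa [hw] using (count_take_ofFn w.get l w.length).symm
  let g : κ × Fin n → Fin w.length := fun x => Finset.orderEmbOfFin _ (hcard x.1) x.2
  have hwg x : w.get (g x) = x.1 :=
    (Finset.mem_filter.1 (Finset.orderEmbOfFin_mem _ (hcard x.1) x.2)).2
  have hg : Function.Bijective g := by
    constructor
    · rintro ⟨l, i⟩ ⟨l', j⟩ h
      obtain rfl : l = l' := by simpa only [hwg] using congrArg w.get h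
      simpa [g] using h
    · intro q
      have hq : q ∈ Set.range (Finset.orderEmbOfFin _ (hcard (w.get q))) := by simp
      obtain ⟨i, hi⟩ := hq
      exact ⟨(w.get q, i), hi⟩
  refine ⟨Equiv.ofBijective g hg, fun l => (Finset.orderEmbOfFin _ (hcard l)).strictMono, ?_⟩
  refine (congrArg List.ofFn (funext fun q => ?_)).trans (List.ofFn_get w)
  rw [← hwg, ← Equiv.ofBijective_apply g hg, Equiv.apply_symm_apply]

end RowWords

section ArrangementWords

variable {n m : ℕ} {f : Fin 3 × Fin n ≃ Fin m}

theorem IsArrangement.lowerStep_eq_upperStep (hf : IsArrangement f) :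
    (rowWord f).filterMap lowerStep = (rowWord f).filterMap upperStep := by
  apply eq_of_forall_precedes_iff
  · rw [count_U_lowerStep, count_U_upperStep, count_rowWord, count_rowWord]
  · rw [count_D_lowerStep, count_D_upperStep, count_rowWord, count_rowWord]
  · rw [count_U_lowerStep, count_D_lowerStep, count_rowWord, count_rowWord]
    intro i hi j hj
    rw [precedes_lowerStep, precedes_upperStep,
      precedes_rowWord_iff hf.row_strictMono 1 0 ⟨i, hi⟩ ⟨j, hj⟩,
      precedes_rowWord_iff hf.row_strictMono 2 1 ⟨i, hi⟩ ⟨j, hj⟩, hf.lt_iff]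

/-- The Dyck word describing how any two consecutive rows of an arrangement are interleaved. -/
def IsArrangement.dyckWord (hf : IsArrangement f) : DyckWord where
  toList := (rowWord f).filterMap lowerStep
  count_U_eq_count_D := by
    rw [count_U_lowerStep, count_D_lowerStep, count_rowWord, count_rowWord]
  count_D_le_count_U k := by
    by_contra! hlt
    set q := ((rowWord f).filterMap lowerStep).take k
    have hn : q.count U < n := hlt.trans_le <| by
      rw [← count_rowWord f 1, ← count_D_lowerStep]
      exact (List.take_sublist k _).count_le D
    have hq : Precedes ((rowWord f).filterMap lowerStep) D (q.count U) U (q.count U) :=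
      ⟨q, List.take_prefix _ _, hlt, le_rfl⟩
    rw [precedes_lowerStep, precedes_rowWord_iff hf.row_strictMono 1 0 ⟨_, hn⟩ ⟨_, hn⟩] at hq
    exact hq.not_gt (hf.col_strictMono _ (by decide))

theorem IsArrangement.semilength_dyckWord (hf : IsArrangement f) : hf.dyckWord.semilength = n :=
  (count_U_lowerStep _).trans (count_rowWord f 0)

theorem IsArrangement.precedes_dyckWord_iff (hf : IsArrangement f) (i j : Fin n) :
    Precedes hf.dyckWord.toList D i U j ↔ f (2, i) < f (1, j) := by
  rw [dyckWord, precedes_lowerStep, precedes_rowWord_iff hf.row_strictMono, hf.lt_iff]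

theorem isArrangement_of_rowWord_mem_shuffles {p : DyckWord}
    (hf : ∀ l, StrictMono fun i => f (l, i)) (hw : rowWord f ∈ shuffles p.toList p.toList) :
    IsArrangement f := by
  have lower i j : f (1, i) < f (0, j) ↔ Precedes p.toList D i U j := by
    rw [← hw.1, precedes_lowerStep, precedes_rowWord_iff hf]
  have upper i j : f (2, i) < f (1, j) ↔ Precedes p.toList D i U j := by
    rw [← hw.2, precedes_upperStep, precedes_rowWord_iff hf]
  refine ⟨hf, fun i => ?_, fun i j => (lower i j).trans (upper i j).symm⟩
  rw [Fin.strictMono_iff_lt_succ, Fin.forall_fin_two]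
  have h01 : f (0, i) ≤ f (1, i) := not_lt.1 fun h => not_precedes_self p i ((lower i i).1 h)
  have h12 : f (1, i) ≤ f (2, i) := not_lt.1 fun h => not_precedes_self p i ((upper i i).1 h)
  exact ⟨h01.lt_of_ne (f.injective.ne (by simp)), h12.lt_of_ne (f.injective.ne (by simp))⟩

theorem card_arrangements (p : DyckWord) (hp : p.semilength = n) :
    Nat.card {f : {f : Fin 3 × Fin n ≃ Fin (3 * n) // IsArrangement f} // f.2.dyckWord = p} =
      (shuffles p.toList p.toList).ncard := by
  rw [← Nat.card_coe_set_eq]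
  refine Nat.card_eq_of_bijective (fun f => ⟨rowWord f.1.1, ?_, ?_⟩) ⟨?_, ?_⟩
  · exact congrArg DyckWord.toList f.2
  · exact f.1.2.lowerStep_eq_upperStep.symm.trans (congrArg DyckWord.toList f.2)
  · rintro ⟨⟨f, hf⟩, hfp⟩ ⟨⟨g, hg⟩, hgp⟩ h
    simpa using eq_of_rowWord_eq hf.row_strictMono hg.row_strictMono (congrArg Subtype.val h)
  · rintro ⟨w, hlower, hupper⟩
    have hD : p.toList.count D = n := p.semilength_eq_count_D.symm.trans hp
    have hcount l : w.count l = n := by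
      fin_cases l
      · exact (count_U_lowerStep w).symm.trans ((congrArg (List.count U) hlower).trans hp)
      · exact (count_D_lowerStep w).symm.trans ((congrArg (List.count D) hlower).trans hD)
      · exact (count_D_upperStep w).symm.trans ((congrArg (List.count D) hupper).trans hD)
    have hlen : w.length = 3 * n := by
      simpa [hcount, mul_comm] using
        (Multiset.sum_count_eq_card (s := Finset.univ) (m := (w : Multiset (Fin 3)))
          (by simp)).symm
    obtain ⟨f, hf, rfl⟩ := exists_rowWord_eq hlen hcount
    have hf' := isArrangement_of_rowWord_mem_shuffles hf ⟨hlower, hupper⟩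
    exact ⟨⟨⟨f, hf'⟩, DyckWord.ext hlower⟩, rfl⟩

theorem IsArrangement.isOrientation_iff {f : Fin 3 × Fin (n + 1) ≃ Fin m} (hf : IsArrangement f)
    (t : Fin (n + 1) → Bool) :
    IsOrientation f t ↔
      ∀ i : Fin n, ¬ f (2, i.castSucc) < f (1, i.succ) → t i.castSucc = t i.succ := by
  constructor
  · intro ht i hlt
    by_contra hne
    exact hlt (ht _ _ i.castSucc_lt_succ hne)
  · intro ht i j hij
    contrapose!
    intro hji
    induction j using Fin.induction with
    | zero => exact absurd hij (Fin.not_lt_zero _)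
    | succ j ih =>
      have hij' : i ≤ j.castSucc := Fin.le_castSucc_iff.2 hij
      have hstep : t j.castSucc = t j.succ :=
        ht j (not_lt.2 (hji.trans ((hf.row_strictMono 2).monotone hij')))
      obtain rfl | hlt := hij'.eq_or_lt
      · exact hstep
      · refine (ih hlt ?_).trans hstep
        exact ((hf.row_strictMono 1).monotone j.castSucc_lt_succ.le).trans hji

theorem IsArrangement.card_orientations (hf : IsArrangement f) :
    Nat.card {t : Fin n → Bool // IsOrientation f t} = 2 ^ h hf.dyckWord := by
  classical
  rw [h_eq_card, hf.semilength_dyckWord]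
  cases n with
  | zero => simp [IsOrientation]
  | succ n =>
    rw [Nat.card_congr (Equiv.subtypeEquivRight hf.isOrientation_iff), card_colorings_eq_pow]
    have hlast := precedes_last hf.dyckWord hf.semilength_dyckWord
    have hprec (i : Fin n) := hf.precedes_dyckWord_iff i.castSucc i.succ
    simp only [Fin.val_castSucc, Fin.val_succ] at hprec
    rw [Finset.range_add_one, Finset.filter_insert, if_pos hlast,
      Finset.card_insert_of_notMem (by simp), Nat.card_eq_fintype_card, Fintype.card_bool]
    congr 2
    simp only [Finset.card_filter, Finset.sum_range, hprec]
    congr!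

end ArrangementWords

end ThreeCycles

theorem theorem321 (n : ℕ) (hn : 1 ≤ n) :
    (ThreeCycles.avStar n ThreeCycles.pattern321).ncard =
      ∑ D : {p : DyckWord // p.semilength = n},
        2 ^ ThreeCycles.h D.1 *
          ∏ i ∈ Finset.Icc 1 (n - 1),
            (ThreeCycles.r D.1 i + ThreeCycles.s D.1 i).choose (ThreeCycles.r D.1 i) := by
  classical
  open ThreeCycles in
  let dyck (f : {f : Fin 3 × Fin n ≃ Fin (3 * n) // IsArrangement f}) :
      {p : DyckWord // p.semilength = n} := ⟨f.2.dyckWord, f.2.semilength_dyckWord⟩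
  rw [ncard_avStar_pattern321, Nat.card_sigma, ← Finset.sum_fiberwise _ dyck]
  refine Finset.sum_congr rfl fun D _ => ?_
  have hfib : (Finset.univ.filter fun f => dyck f = D).card =
      gapProduct D.1.toList D.1.toList := by
    rw [← ncard_shuffles _ _ D.1.count_U_eq_count_D.symm, ← card_arrangements D.1 D.2,
      Nat.card_eq_fintype_card, Fintype.card_subtype]
    simp only [dyck, Subtype.ext_iff]
  have horient f (hf : f ∈ Finset.univ.filter fun f => dyck f = D) :
      Nat.card {t : Fin n → Bool // IsOrientation f.1 t} = 2 ^ h D.1 := by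
    rw [f.2.card_orientations, ← (Finset.mem_filter.1 hf).2]
  rw [Finset.sum_congr rfl horient, Finset.sum_const, smul_eq_mul, mul_comm, hfib,
    gapProduct_self, D.2]
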